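/- Let $\mathbb{L}^3$ be $\mathbb{R}^3$ with the Lorentzian product $\langle v,v'\rangle=xx'+yy'-zz'$, and let $\mathbb{H}^2=\{v=(x,y,z)\in\mathbb{L}^3:\langle v,v\rangle=-1,\ z>0\}$ be the hyperbolic plane with the induced Riemannian metric, oriented so that the isometry $(x,y,z)\mapsto\frac{1}{1+z}(x,y)$ onto the Poincaré disk is orientation preserving. Let $\gamma:\mathbb{R}\to\mathbb{H}^2$ be a smooth curve parametrized by arc length $s$, with unit tangent $T=\gamma'$, unit normal $N$ such that $(T,N)$ is a positively oriented frame, and signed geodesic curvature $\kappa$ defined by $\nabla_TT=\kappa N$. For $p>1$, such a curve is called $p$-elastic if $\kappa$ satisfies the Euler–Lagrange equation of the functional $\int_\gamma\kappa^p\,ds$, $$p\,\frac{d^2}{ds^2}\left(\kappa^{p-1}\right)+(p-1)\kappa^{p+1}-p\,\kappa^{p-1}=0,$$ where $\kappa>0$ is required if $p\notin\mathbb{N}$. The curve is closed if it is periodic, and convex if $\kappa>0$ everywhere. Angles, rotations and winding numbers are taken about the pole $(0,0,1)$, that is, about the center of the Poincaré disk. **Theorem.** Let $p>1$ be a real number.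 1. For every $q\in\mathbb{Q}$ with $1<2q<\sqrt2$ there is a closed convex $p$-elastic curve $\gamma_q$ in $\mathbb{H}^2$ with nonconstant curvature that is associated to $q$ in the following sense: it avoids the pole, and its polar angle increases by $2\pi q$ along each least period of its curvature. 2. Equivalently, for every pair $(n,m)$ of relatively prime natural numbers with $m<2n<\sqrt2\,m$ there is a closed convex $p$-elastic curve $\gamma_{n,m}$ in $\mathbb{H}^2$ with nonconstant curvature whose least period is exactly $m$ times the least period of its curvature, which over its least period has winding number $n$ about the pole, and which has an $m$-fold symmetry, that is, its trace is invariant under the rotation through $2\pi/m$ about the pole. -/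

import Mathlib

open scoped ContDiff

noncomputable section

namespace HypElastic

/-- The Lorentzian product `x x' + y y' - z z'` on `ℝ³`. -/
def lorentz (u v : Fin 3 → ℝ) : ℝ := u 0 * v 0 + u 1 * v 1 - u 2 * v 2

/-- The hyperbolic plane: the upper sheet of the hyperboloid `⟨v, v⟩ = -1`. -/
def hyperbolicPlane : Set (Fin 3 → ℝ) := {v | lorentz v v = -1 ∧ 0 < v 2}

/-- The Lorentzian cross product, the vector with `⟨u × v, w⟩ = det (u, v, w)` for all `w`. -/
def lorentzCross (u v : Fin 3 → ℝ) : Fin 3 → ℝ :=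
  ![u 1 * v 2 - u 2 * v 1, u 2 * v 0 - u 0 * v 2, -(u 0 * v 1 - u 1 * v 0)]

theorem lorentz_lorentzCross (u v w : Fin 3 → ℝ) :
    lorentz (lorentzCross u v) w = Matrix.det !![u 0, u 1, u 2; v 0, v 1, v 2; w 0, w 1, w 2] := by
  simp [lorentz, lorentzCross, Matrix.det_fin_three]
  ring

/-- A smooth curve `γ : ℝ → ℍ²` parametrized by arc length (hence immersed and complete). -/
structure IsArcLengthCurve (γ : ℝ → Fin 3 → ℝ) : Prop where
  smooth : ContDiff ℝ ∞ γ
  mem : ∀ s, γ s ∈ hyperbolicPlane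
  unit_speed : ∀ s, lorentz (deriv γ s) (deriv γ s) = 1

/-- The covariant derivative of a vector field `V` along a curve `γ` in `ℍ²` with respect to the
Levi-Civita connection of `ℍ²`: the Lorentz-orthogonal projection of `V'` onto the tangent plane
of `ℍ²` (the position vector `γ` is normal to `ℍ²`, with `⟨γ, γ⟩ = -1`). -/
def covDeriv (γ V : ℝ → Fin 3 → ℝ) (s : ℝ) : Fin 3 → ℝ :=
  deriv V s + lorentz (deriv V s) (γ s) • γ s

/-- The unit normal `N` of an arc length curve in `ℍ²`: the frame `(T, N)` is orthonormal and
positively oriented for the orientation of `ℍ²` in which `det (γ, T, N) > 0`, that is the one that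
the Poincaré disk inherits from the standard orientation of the plane. -/
def unitNormal (γ : ℝ → Fin 3 → ℝ) (s : ℝ) : Fin 3 → ℝ := lorentzCross (γ s) (deriv γ s)

/-- The signed geodesic curvature `κ = ⟨∇_T T, N⟩` of an arc length curve, so `∇_T T = κ N`. -/
def curvature (γ : ℝ → Fin 3 → ℝ) (s : ℝ) : ℝ :=
  lorentz (covDeriv γ (deriv γ) s) (unitNormal γ s)

/-- `γ` is a (free) `p`-elastic curve in `ℍ²`: an arc length curve whose curvature satisfies
`p (κ^(p-1))'' + (p-1) κ^(p+1) - p κ^(p-1) = 0`, the Euler-Lagrange equation of `∫ κ^p ds`.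
Unless `p` is a natural number, the functional only acts on curves with `κ > 0`. -/
structure IsPElastic (p : ℝ) (γ : ℝ → Fin 3 → ℝ) : Prop where
  curve : IsArcLengthCurve γ
  pos : (∀ k : ℕ, p ≠ k) → ∀ s, 0 < curvature γ s
  euler_lagrange : ∀ s,
    p * iteratedDeriv 2 (fun t => curvature γ t ^ (p - 1)) s
      + (p - 1) * curvature γ s ^ (p + 1) - p * curvature γ s ^ (p - 1) = 0

/-- Convex curves: positive curvature everywhere. -/
def IsConvex (γ : ℝ → Fin 3 → ℝ) : Prop := ∀ s, 0 < curvature γ s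

def HasNonconstantCurvature (γ : ℝ → Fin 3 → ℝ) : Prop :=
  ∃ s t, curvature γ s ≠ curvature γ t

/-- Closed curves: `γ : ℝ → ℍ²` is periodic. -/
def IsClosedCurve (γ : ℝ → Fin 3 → ℝ) : Prop := ∃ L : ℝ, 0 < L ∧ Function.Periodic γ L

/-- `T` is the least positive period of `f`. -/
def IsLeastPeriod {α : Type*} (f : ℝ → α) (T : ℝ) : Prop :=
  IsLeast {L : ℝ | 0 < L ∧ Function.Periodic f L} T

/-- The isometry of `ℍ²` onto the Poincaré disk; the pole `(0, 0, 1)` goes to the center `0`. -/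
def toDisk (v : Fin 3 → ℝ) : ℂ := ⟨v 0 / (1 + v 2), v 1 / (1 + v 2)⟩

/-- `θ` is a continuous polar angle about the pole along `γ`, which avoids the pole. -/
structure IsPolarAngle (γ : ℝ → Fin 3 → ℝ) (θ : ℝ → ℝ) : Prop where
  continuous : Continuous θ
  ne_pole : ∀ s, toDisk (γ s) ≠ 0
  polar : ∀ s, toDisk (γ s) = ‖toDisk (γ s)‖ * Complex.exp (θ s * Complex.I)

/-- The polar angle about the pole increases by `φ` along every parameter interval `[s, s + T]`. -/
def HasAngularProgression (γ : ℝ → Fin 3 → ℝ) (T φ : ℝ) : Prop :=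
  ∃ θ, IsPolarAngle γ θ ∧ ∀ s, θ (s + T) - θ s = φ

/-- The closed curve `γ|[0, L]` has winding number `n` about the pole. -/
def HasWindingNumber (γ : ℝ → Fin 3 → ℝ) (L : ℝ) (n : ℤ) : Prop :=
  Function.Periodic γ L ∧ HasAngularProgression γ L (2 * Real.pi * n)

/-- The rotation of `ℍ²` through the angle `φ` about the pole. -/
def rotation (φ : ℝ) (v : Fin 3 → ℝ) : Fin 3 → ℝ :=
  ![Real.cos φ * v 0 - Real.sin φ * v 1, Real.sin φ * v 0 + Real.cos φ * v 1, v 2]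

/-- The trace of `γ` is invariant under the rotation through `2π/m` about the pole. -/
def HasFoldSymmetry (γ : ℝ → Fin 3 → ℝ) (m : ℕ) : Prop :=
  rotation (2 * Real.pi / m) '' Set.range γ = Set.range γ

/-- `γ` is associated to `q`: along the least period of its curvature, the polar angle about the
pole increases by `2πq`. -/
def IsAssociatedTo (γ : ℝ → Fin 3 → ℝ) (q : ℚ) : Prop :=
  ∃ ρ : ℝ, IsLeastPeriod (curvature γ) ρ ∧ HasAngularProgression γ ρ (2 * Real.pi * q)

/-- `γ` is of type `(n, m)`: it closes up after exactly `m` periods of its curvature, it then has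
winding number `n` about the pole, and it has an `m`-fold rotational symmetry about the pole. -/
def IsOfType (γ : ℝ → Fin 3 → ℝ) (n m : ℕ) : Prop :=
  ∃ ρ : ℝ, IsLeastPeriod (curvature γ) ρ ∧ IsLeastPeriod γ (m * ρ) ∧
    HasWindingNumber γ (m * ρ) n ∧ HasFoldSymmetry γ m

end HypElastic

end

namespace HypElastic

open Filter Topology Set

/-! With `b = 1 / (p - 1)`, the curves are built so that the height `z` over the pole is
proportional to `κ^(p-1)`. Writing `z = exp η / a`, the Euler–Lagrange equation follows from the
one-dimensional conservative system `η'^2 + a^2 * potential b η = 1`. The potential is convex with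
minimum `1 + 1 / b` at `0`, so for `a^2 * (1 + 1 / b + R^2) = 1` with `R > 0` the motion is a
nonconstant oscillation. Curvature is `(1 + b) * e` with `e = a / √b * exp (b η)`, and the polar
angle satisfies `θ' = e z / (z^2 - 1)`. Everything then rests on the progression `Λ` of `θ` over one
oscillation: if `Λ = 2π n / m`, the curve closes after `m` oscillations.

The potential well is straightened by `potentialRoot`, the signed root of `potential b - (1 + 1 /
b)`. Putting `potentialRoot b η = R sin φ` turns every orbit into a full turn of the phase `φ`, so
that orbits of all amplitudes are compared on the fixed interval `[0, 2π]`.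

For large `R` the curve passes close to the pole and `θ'` is not bounded uniformly. But `arctan (η'
/ e)` is the angle between the curve and the circles about the pole. Subtracting this periodic term
leaves, up to a constant, the tangent angle in the conformal disk, whose rate `angleDensity` is
uniformly bounded (`angle_identity`). Its integral `totalAngle` is continuous in `R`, equals `√2 π`
at `R = 0` (`totalAngle_zero`) and tends to `π` as `R → ∞` (`tendsto_totalAngle`). The intermediate
value theorem gives every `Λ` in between (`exists_profile`), and `IsProfile` carries the result to
the geometry. -/

/-- A differentiable function on `ℝ` with positive derivative and limits `±∞` has a differentiable
inverse. -/
theorem exists_inverse_of_deriv_pos {f f' : ℝ → ℝ} (hf : ∀ x, HasDerivAt f (f' x) x)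
    (hpos : ∀ x, 0 < f' x) (htop : Tendsto f atTop atTop) (hbot : Tendsto f atBot atBot) :
    StrictMono f ∧ ∃ g : ℝ → ℝ, Continuous g ∧ (∀ x, f (g x) = x) ∧ (∀ x, g (f x) = x) ∧
      ∀ x, HasDerivAt g (f' (g x))⁻¹ x := by
  have hmono : StrictMono f := strictMono_of_hasDerivAt_pos hf hpos
  have hcont : Continuous f := continuous_iff_continuousAt.2 fun x => (hf x).continuousAt
  refine ⟨hmono, ?_⟩
  let e := hmono.orderIsoOfSurjective f (hcont.surjective htop hbot)
  have he : ∀ x, f (e.symm x) = x := fun x => e.apply_symm_apply x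
  refine ⟨e.symm, e.symm.continuous, he, fun x => e.symm_apply_apply x, fun x => ?_⟩
  exact (hf _).of_local_left_inverse e.symm.continuous.continuousAt (hpos _).ne'
    (Eventually.of_forall he)

/-! ### The potential well and its signed square root -/

/-- The potential of the logarithmic curvature of a `p`-elastic curve, where `b = 1 / (p - 1)`. -/
noncomputable def potential (b x : ℝ) : ℝ := Real.exp (-2 * x) + Real.exp (2 * b * x) / b

/-- The function `(potential b x - potential b 0) / x ^ 2`, extended continuously to `x = 0`. -/
noncomputable def potentialQuot (b x : ℝ) : ℝ :=
  ∫ t in (0 : ℝ)..1, (1 - t) * (4 * Real.exp (-2 * (t * x)) + 4 * b * Real.exp (2 * b * (t * x)))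

/-- The function `(exp (2 b x) - exp (-2 x)) / x`, extended continuously to `x = 0`. -/
noncomputable def forceQuot (b x : ℝ) : ℝ :=
  ∫ t in (0 : ℝ)..1, (2 * Real.exp (-2 * (t * x)) + 2 * b * Real.exp (2 * b * (t * x)))

/-- Taylor's formula with integral remainder at the minimum `0`, where the first derivative
vanishes. The antiderivative is `(1 - t) V'(tx) x + V(tx)` with `V = potential b`. The integral form
makes continuity and positivity of the quotient at `x = 0` immediate. -/
theorem potential_sub (b x : ℝ) (hb : 0 < b) :
    potential b x - (1 + 1 / b) = x ^ 2 * potentialQuot b x := by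
  have h : ∀ t ∈ uIcc (0 : ℝ) 1, HasDerivAt
      (fun t : ℝ => (1 - t) * (-2 * x * Real.exp (-2 * (t * x)) + 2 * x * Real.exp (2 * b * (t * x)))
        + (Real.exp (-2 * (t * x)) + Real.exp (2 * b * (t * x)) / b))
      (x ^ 2 * ((1 - t) * (4 * Real.exp (-2 * (t * x)) + 4 * b * Real.exp (2 * b * (t * x))))) t := by
    intro t _
    have h1 : HasDerivAt (fun t : ℝ => Real.exp (-2 * (t * x)))
        (Real.exp (-2 * (t * x)) * (-2 * (1 * x))) t :=
      (((hasDerivAt_id t).mul_const x).const_mul (-2)).exp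
    have h2 : HasDerivAt (fun t : ℝ => Real.exp (2 * b * (t * x)))
        (Real.exp (2 * b * (t * x)) * (2 * b * (1 * x))) t :=
      (((hasDerivAt_id t).mul_const x).const_mul (2 * b)).exp
    have h3 : HasDerivAt (fun t : ℝ => 1 - t) (-1) t := by
      simpa using (hasDerivAt_id t).const_sub 1
    refine ((h3.mul ((h1.const_mul (-2 * x)).add (h2.const_mul (2 * x)))).add
      (h1.add (h2.div_const b))).congr_deriv ?_
    simp only [Pi.add_apply]
    field_simp
    ring
  have := intervalIntegral.integral_eq_sub_of_hasDerivAt h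
    (Continuous.intervalIntegrable (by fun_prop) _ _)
  rw [intervalIntegral.integral_const_mul] at this
  rw [potentialQuot, this, potential]
  simp

theorem mul_forceQuot (b x : ℝ) :
    x * forceQuot b x = Real.exp (2 * b * x) - Real.exp (-2 * x) := by
  have h : ∀ t ∈ uIcc (0 : ℝ) 1, HasDerivAt
      (fun t : ℝ => Real.exp (2 * b * (t * x)) - Real.exp (-2 * (t * x)))
      (x * (2 * Real.exp (-2 * (t * x)) + 2 * b * Real.exp (2 * b * (t * x)))) t := by
    intro t _
    have h1 : HasDerivAt (fun t : ℝ => Real.exp (-2 * (t * x)))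
        (Real.exp (-2 * (t * x)) * (-2 * (1 * x))) t :=
      (((hasDerivAt_id t).mul_const x).const_mul (-2)).exp
    have h2 : HasDerivAt (fun t : ℝ => Real.exp (2 * b * (t * x)))
        (Real.exp (2 * b * (t * x)) * (2 * b * (1 * x))) t :=
      (((hasDerivAt_id t).mul_const x).const_mul (2 * b)).exp
    refine (h2.sub h1).congr_deriv ?_
    ring
  have := intervalIntegral.integral_eq_sub_of_hasDerivAt h
    (Continuous.intervalIntegrable (by fun_prop) _ _)
  rw [intervalIntegral.integral_const_mul] at this
  rw [forceQuot, this]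
  simp

theorem continuous_potentialQuot (b : ℝ) : Continuous (potentialQuot b) := by
  unfold potentialQuot
  apply intervalIntegral.continuous_parametric_intervalIntegral_of_continuous'
  fun_prop

theorem continuous_forceQuot (b : ℝ) : Continuous (forceQuot b) := by
  unfold forceQuot
  apply intervalIntegral.continuous_parametric_intervalIntegral_of_continuous'
  fun_prop

theorem integral_one_sub_mul (c : ℝ) : ∫ t in (0 : ℝ)..1, (1 - t) * c = c / 2 := by
  rw [intervalIntegral.integral_mul_const, intervalIntegral.integral_sub (by simp) (by simp)]
  simp
  ring

theorem potentialQuot_zero (b : ℝ) : potentialQuot b 0 = 2 * (1 + b) := by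
  simp only [potentialQuot, integral_one_sub_mul, mul_zero, Real.exp_zero]
  ring

theorem forceQuot_zero (b : ℝ) : forceQuot b 0 = 2 * (1 + b) := by
  simp [forceQuot]
  ring

theorem potentialQuot_ge_of_nonneg {b x : ℝ} (hb : 0 < b) (hx : 0 ≤ x) :
    2 * b ≤ potentialQuot b x := by
  have h : ∫ t in (0 : ℝ)..1, (1 - t) * (4 * b) ≤ potentialQuot b x := by
    refine intervalIntegral.integral_mono_on zero_le_one
      (Continuous.intervalIntegrable (by fun_prop) _ _)
      (Continuous.intervalIntegrable (by fun_prop) _ _) fun t ht => ?_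
    have h1 : 1 ≤ Real.exp (2 * b * (t * x)) := Real.one_le_exp (by have := ht.1; positivity)
    have := Real.exp_pos (-2 * (t * x))
    exact mul_le_mul_of_nonneg_left (by nlinarith) (sub_nonneg.2 ht.2)
  rw [integral_one_sub_mul] at h
  linarith

theorem potentialQuot_ge_of_nonpos {b x : ℝ} (hb : 0 < b) (hx : x ≤ 0) :
    2 ≤ potentialQuot b x := by
  have h : ∫ t in (0 : ℝ)..1, (1 - t) * 4 ≤ potentialQuot b x := by
    refine intervalIntegral.integral_mono_on zero_le_one
      (Continuous.intervalIntegrable (by fun_prop) _ _)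
      (Continuous.intervalIntegrable (by fun_prop) _ _) fun t ht => ?_
    have h1 : 1 ≤ Real.exp (-2 * (t * x)) := Real.one_le_exp (by nlinarith [ht.1])
    have := Real.exp_pos (2 * b * (t * x))
    exact mul_le_mul_of_nonneg_left (by nlinarith) (sub_nonneg.2 ht.2)
  rw [integral_one_sub_mul] at h
  linarith

theorem potentialQuot_pos {b : ℝ} (hb : 0 < b) (x : ℝ) : 0 < potentialQuot b x := by
  rcases le_total 0 x with hx | hx
  · linarith [potentialQuot_ge_of_nonneg hb hx]
  · linarith [potentialQuot_ge_of_nonpos hb hx]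

theorem forceQuot_pos {b : ℝ} (hb : 0 < b) (x : ℝ) : 0 < forceQuot b x := by
  refine intervalIntegral.intervalIntegral_pos_of_pos_on
    (Continuous.intervalIntegrable (by fun_prop) _ _) (fun t _ => by positivity) zero_lt_one

/-- The signed square root of `potential b x - potential b 0`. -/
noncomputable def potentialRoot (b x : ℝ) : ℝ := x * √(potentialQuot b x)

/-- The derivative of `potentialRoot b`. -/
noncomputable def potentialRootDeriv (b x : ℝ) : ℝ := forceQuot b x / √(potentialQuot b x)

theorem potentialRoot_sq {b : ℝ} (hb : 0 < b) (x : ℝ) :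
    potentialRoot b x ^ 2 = potential b x - (1 + 1 / b) := by
  rw [potential_sub b x hb, potentialRoot, mul_pow, Real.sq_sqrt (potentialQuot_pos hb x).le]

theorem potentialRoot_mul_deriv {b : ℝ} (hb : 0 < b) (x : ℝ) :
    potentialRoot b x * potentialRootDeriv b x = Real.exp (2 * b * x) - Real.exp (-2 * x) := by
  have := Real.sqrt_pos.2 (potentialQuot_pos hb x)
  rw [← mul_forceQuot, potentialRoot, potentialRootDeriv]
  field_simp

theorem potentialRootDeriv_pos {b : ℝ} (hb : 0 < b) (x : ℝ) : 0 < potentialRootDeriv b x :=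
  div_pos (forceQuot_pos hb x) (Real.sqrt_pos.2 (potentialQuot_pos hb x))

theorem continuous_potentialRoot (b : ℝ) : Continuous (potentialRoot b) :=
  continuous_id.mul (continuous_potentialQuot b).sqrt

theorem continuous_potentialRootDeriv {b : ℝ} (hb : 0 < b) : Continuous (potentialRootDeriv b) :=
  (continuous_forceQuot b).div (continuous_potentialQuot b).sqrt
    fun x => (Real.sqrt_pos.2 (potentialQuot_pos hb x)).ne'

theorem hasDerivAt_potential {b : ℝ} (hb : 0 < b) (x : ℝ) :
    HasDerivAt (potential b) (2 * (Real.exp (2 * b * x) - Real.exp (-2 * x))) x := by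
  have h1 : HasDerivAt (fun x : ℝ => Real.exp (-2 * x)) (Real.exp (-2 * x) * (-2 * 1)) x :=
    ((hasDerivAt_id x).const_mul (-2)).exp
  have h2 : HasDerivAt (fun x : ℝ => Real.exp (2 * b * x)) (Real.exp (2 * b * x) * (2 * b * 1)) x :=
    ((hasDerivAt_id x).const_mul (2 * b)).exp
  refine (h1.add (h2.div_const b)).congr_deriv ?_
  field_simp
  ring

/-- Away from `0` this is the quotient rule. The formula for the derivative is continuous at `0`,
which extends differentiability to that point. -/
theorem hasDerivAt_potentialRoot {b : ℝ} (hb : 0 < b) (x : ℝ) :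
    HasDerivAt (potentialRoot b) (potentialRootDeriv b x) x := by
  refine hasDerivAt_of_hasDerivAt_of_ne' (x := 0) (fun y hy => ?_)
    (continuous_potentialRoot b).continuousAt (continuous_potentialRootDeriv hb).continuousAt x
  have hP := potentialQuot_pos hb y
  have hev : potentialQuot b =ᶠ[𝓝 y] fun z => (potential b z - (1 + 1 / b)) / z ^ 2 := by
    filter_upwards [isOpen_ne.mem_nhds hy] with z hz
    rw [potential_sub b z hb, mul_div_cancel_left₀ _ (pow_ne_zero 2 hz)]
  have h1 := (((hasDerivAt_potential hb y).sub_const (1 + 1 / b)).div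
    ((hasDerivAt_id y).pow 2) (pow_ne_zero 2 hy)).congr_of_eventuallyEq hev
  refine ((hasDerivAt_id y).mul (h1.sqrt hP.ne')).congr_deriv ?_
  have hs : √(potentialQuot b y) ^ 2 = potentialQuot b y := Real.sq_sqrt hP.le
  have hs0 := Real.sqrt_pos.2 hP
  rw [← mul_forceQuot, potential_sub b y hb, potentialRootDeriv]
  simp only [id, Pi.pow_apply]
  field_simp
  rw [hs]
  ring

theorem tendsto_potentialRoot_atTop {b : ℝ} (hb : 0 < b) :
    Tendsto (potentialRoot b) atTop atTop := by
  refine tendsto_atTop_mono' _ ?_ (tendsto_id.atTop_mul_const (Real.sqrt_pos.2 (mul_pos two_pos hb)))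
  filter_upwards [eventually_ge_atTop 0] with x hx
  exact mul_le_mul_of_nonneg_left (Real.sqrt_le_sqrt (potentialQuot_ge_of_nonneg hb hx)) hx

theorem tendsto_potentialRoot_atBot {b : ℝ} (hb : 0 < b) :
    Tendsto (potentialRoot b) atBot atBot := by
  refine tendsto_atBot_mono' _ ?_ (tendsto_id.atBot_mul_const (Real.sqrt_pos.2 two_pos))
  filter_upwards [eventually_le_atBot 0] with x hx
  exact mul_le_mul_of_nonpos_left (Real.sqrt_le_sqrt (potentialQuot_ge_of_nonpos hb hx)) hx

theorem strictMono_potentialRoot {b : ℝ} (hb : 0 < b) : StrictMono (potentialRoot b) :=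
  strictMono_of_hasDerivAt_pos (hasDerivAt_potentialRoot hb) (potentialRootDeriv_pos hb)

theorem exists_potentialRoot_inverse {b : ℝ} (hb : 0 < b) :
    ∃ Y : ℝ → ℝ, Continuous Y ∧ (∀ x, potentialRoot b (Y x) = x) ∧
      (∀ x, Y (potentialRoot b x) = x) ∧
      ∀ x, HasDerivAt Y (potentialRootDeriv b (Y x))⁻¹ x :=
  (exists_inverse_of_deriv_pos (hasDerivAt_potentialRoot hb) (potentialRootDeriv_pos hb)
    (tendsto_potentialRoot_atTop hb) (tendsto_potentialRoot_atBot hb)).2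

/-! ### Asymptotics at the two ends of the potential well -/

theorem tendsto_exp_mul_atTop_zero {c : ℝ} (hc : c < 0) :
    Tendsto (fun x => Real.exp (c * x)) atTop (𝓝 0) :=
  Real.tendsto_exp_atBot.comp (tendsto_id.const_mul_atTop_of_neg hc)

theorem tendsto_exp_mul_atBot_zero {c : ℝ} (hc : 0 < c) :
    Tendsto (fun x => Real.exp (c * x)) atBot (𝓝 0) :=
  Real.tendsto_exp_atBot.comp (tendsto_id.const_mul_atBot hc)

/-- With `X = potentialRoot b` and `X X' = exp (2bx) - exp (-2x)`, the quotient is `X exp (-bx) / (1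
- exp (-2(1+b)x))`. Here `X ^ 2` grows like `exp (2bx) / b`. -/
theorem tendsto_exp_div_potentialRootDeriv_atTop {b : ℝ} (hb : 0 < b) :
    Tendsto (fun x => Real.exp (b * x) / potentialRootDeriv b x) atTop (𝓝 (√b)⁻¹) := by
  have e1 := tendsto_exp_mul_atTop_zero (c := -2 * (1 + b)) (by linarith)
  have e2 := tendsto_exp_mul_atTop_zero (c := -2 * b) (by linarith)
  have h : Tendsto (fun x => √(Real.exp (-2 * (1 + b) * x) + 1 / b
      - (1 + 1 / b) * Real.exp (-2 * b * x)) / (1 - Real.exp (-2 * (1 + b) * x))) atTop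
      (𝓝 (√(0 + 1 / b - (1 + 1 / b) * 0) / (1 - 0))) :=
    (((e1.add_const (1 / b)).sub (e2.const_mul (1 + 1 / b))).sqrt).div
      (e1.const_sub 1) (by norm_num)
  have h0 : √(0 + 1 / b - (1 + 1 / b) * 0) / (1 - 0) = (√b)⁻¹ := by simp
  rw [h0] at h
  refine h.congr' ?_
  filter_upwards [eventually_gt_atTop 0] with x hx
  have hX : 0 < potentialRoot b x :=
    mul_pos hx (Real.sqrt_pos.2 (potentialQuot_pos hb x))
  have hw := potentialRootDeriv_pos hb x
  have hm := potentialRoot_mul_deriv hb x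
  have hs := potentialRoot_sq hb x
  have hu := Real.exp_pos (b * x)
  have hv := Real.exp_pos (-x)
  have e3 : Real.exp (-2 * b * x) = (Real.exp (b * x))⁻¹ ^ 2 := by
    rw [← Real.exp_neg, ← Real.exp_nat_mul]; push_cast; ring_nf
  have e4 : Real.exp (2 * b * x) = Real.exp (b * x) ^ 2 := by
    rw [← Real.exp_nat_mul]; push_cast; ring_nf
  have e5 : Real.exp (-2 * x) = Real.exp (-x) ^ 2 := by
    rw [← Real.exp_nat_mul]; push_cast; ring_nf
  have e6 : Real.exp (-2 * (1 + b) * x) = Real.exp (-x) ^ 2 * (Real.exp (b * x))⁻¹ ^ 2 := by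
    rw [← e3, ← e5, ← Real.exp_add]; ring_nf
  rw [potential, e4, e5] at hs
  rw [e4, e5] at hm
  rw [e3, e6]
  generalize Real.exp (b * x) = u at *
  generalize Real.exp (-x) = v at *
  have hsq : √(v ^ 2 * u⁻¹ ^ 2 + 1 / b - (1 + 1 / b) * u⁻¹ ^ 2) = potentialRoot b x * u⁻¹ := by
    rw [← Real.sqrt_sq (show 0 ≤ potentialRoot b x * u⁻¹ by positivity), mul_pow, hs]
    congr 1
    field_simp
  have hd : 1 - v ^ 2 * u⁻¹ ^ 2 = potentialRoot b x * potentialRootDeriv b x * u⁻¹ ^ 2 := by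
    rw [hm]
    field_simp
  rw [hsq, hd]
  field_simp

theorem tendsto_exp_div_potentialRootDeriv_atBot {b : ℝ} (hb : 0 < b) :
    Tendsto (fun x => Real.exp (b * x) / potentialRootDeriv b x) atBot (𝓝 0) := by
  have e1 := tendsto_exp_mul_atBot_zero hb
  have e2 := tendsto_exp_mul_atBot_zero one_pos
  simp only [one_mul] at e2
  have h : Tendsto (fun x => √(1 + Real.exp (b * x) ^ 2 * Real.exp x ^ 2 / b
      - (1 + 1 / b) * Real.exp x ^ 2) * (Real.exp (b * x) * Real.exp x) /
      (1 - Real.exp (b * x) ^ 2 * Real.exp x ^ 2)) atBot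
      (𝓝 (√(1 + 0 ^ 2 * 0 ^ 2 / b - (1 + 1 / b) * 0 ^ 2) * (0 * 0) / (1 - 0 ^ 2 * 0 ^ 2))) :=
    ((((((e1.pow 2).mul (e2.pow 2)).div_const b).const_add 1).sub
      ((e2.pow 2).const_mul (1 + 1 / b))).sqrt.mul (e1.mul e2)).div
      (((e1.pow 2).mul (e2.pow 2)).const_sub 1) (by norm_num)
  have h0 : √(1 + 0 ^ 2 * 0 ^ 2 / b - (1 + 1 / b) * 0 ^ 2) * (0 * 0) / (1 - 0 ^ 2 * 0 ^ 2)
    = (0 : ℝ) := by simp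
  rw [h0] at h
  refine h.congr' ?_
  filter_upwards [eventually_lt_atBot 0] with x hx
  have hX : potentialRoot b x < 0 :=
    mul_neg_of_neg_of_pos hx (Real.sqrt_pos.2 (potentialQuot_pos hb x))
  have hw := potentialRootDeriv_pos hb x
  have hm := potentialRoot_mul_deriv hb x
  have hs := potentialRoot_sq hb x
  have hu := Real.exp_pos (b * x)
  have hv := Real.exp_pos x
  have e4 : Real.exp (2 * b * x) = Real.exp (b * x) ^ 2 := by
    rw [← Real.exp_nat_mul]; push_cast; ring_nf
  have e5 : Real.exp (-2 * x) = (Real.exp x)⁻¹ ^ 2 := by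
    rw [← Real.exp_neg, ← Real.exp_nat_mul]; push_cast; ring_nf
  rw [potential, e4, e5] at hs
  rw [e4, e5] at hm
  generalize Real.exp (b * x) = u at *
  generalize Real.exp x = v at *
  -- On this side `potentialRoot` is the negative root, hence the sign.
  have hsq : √(1 + u ^ 2 * v ^ 2 / b - (1 + 1 / b) * v ^ 2) = -potentialRoot b x * v := by
    rw [← Real.sqrt_sq (show 0 ≤ -potentialRoot b x * v by nlinarith), mul_pow, neg_sq, hs]
    congr 1
    field_simp
  have hd : 1 - u ^ 2 * v ^ 2 = -(potentialRoot b x * potentialRootDeriv b x * v ^ 2) := by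
    rw [hm]
    field_simp
    ring
  rw [hsq, hd]
  have := hX.ne
  field_simp

/-- A continuous real function with limits at `±∞` is bounded. -/
theorem exists_abs_le_of_tendsto {f : ℝ → ℝ} {l l' : ℝ} (hf : Continuous f)
    (htop : Tendsto f atTop (𝓝 l)) (hbot : Tendsto f atBot (𝓝 l')) : ∃ C, ∀ x, |f x| ≤ C := by
  obtain ⟨M, hM⟩ := eventually_atTop.1 (htop.abs.eventually_lt_const (lt_add_one |l|))
  obtain ⟨m, hm⟩ := eventually_atBot.1 (hbot.abs.eventually_lt_const (lt_add_one |l'|))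
  obtain ⟨C, hC⟩ := (isCompact_Icc (a := m) (b := M)).exists_bound_of_continuousOn hf.continuousOn
  refine ⟨max C (max (|l| + 1) (|l'| + 1)), fun x => ?_⟩
  rcases le_total M x with h | h
  · exact (hM x h).le.trans (by simp)
  rcases le_total x m with h' | h'
  · exact (hm x h').le.trans (by simp)
  · exact (hC x ⟨h', h⟩).trans (by simp)

/-! ### The total angle as a function of the amplitude -/

/-- With `Y` the inverse of `potentialRoot b`, the rate of change, with respect to the phase `φ`,
of the polar angle (up to a periodic function) on the orbit of amplitude `R`. -/
noncomputable def angleDensity (b : ℝ) (Y : ℝ → ℝ) (R φ : ℝ) : ℝ :=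
  Real.exp (b * Y (R * Real.sin φ)) / potentialRootDeriv b (Y (R * Real.sin φ)) / √b *
    ((b + (1 + b) * (Real.exp (-Y (R * Real.sin φ)) / √(1 + 1 / b + R ^ 2))) /
      (1 + Real.exp (-Y (R * Real.sin φ)) / √(1 + 1 / b + R ^ 2)))

/-- The total change of the polar angle over one period of the phase. -/
noncomputable def totalAngle (b : ℝ) (Y : ℝ → ℝ) (R : ℝ) : ℝ :=
  ∫ φ in (0 : ℝ)..(2 * Real.pi), angleDensity b Y R φ

theorem continuous_angleDensity {b : ℝ} (hb : 0 < b) {Y : ℝ → ℝ} (hY : Continuous Y) :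
    Continuous (Function.uncurry (angleDensity b Y)) := by
  have hw := continuous_potentialRootDeriv hb
  have h1 : ∀ x, potentialRootDeriv b x ≠ 0 := fun x => (potentialRootDeriv_pos hb x).ne'
  have h2 : √b ≠ 0 := (Real.sqrt_pos.2 hb).ne'
  unfold Function.uncurry angleDensity
  have h3 : ∀ R : ℝ, √(1 + 1 / b + R ^ 2) ≠ 0 := fun R => (Real.sqrt_pos.2 (by positivity)).ne'
  have h4 : ∀ R x : ℝ, 1 + Real.exp x / √(1 + 1 / b + R ^ 2) ≠ 0 := fun R x => by positivity
  refine Continuous.mul (Continuous.div_const (Continuous.div (by fun_prop) (by fun_prop)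
    fun x => h1 _) _) (Continuous.div ?_ ?_ fun x => h4 _ _)
  · exact continuous_const.add (continuous_const.mul (Continuous.div (by fun_prop) (by fun_prop)
      fun x => h3 _))
  · exact continuous_const.add (Continuous.div (by fun_prop) (by fun_prop) fun x => h3 _)

theorem continuous_totalAngle {b : ℝ} (hb : 0 < b) {Y : ℝ → ℝ} (hY : Continuous Y) :
    Continuous (totalAngle b Y) :=
  intervalIntegral.continuous_parametric_intervalIntegral_of_continuous'
    (continuous_angleDensity hb hY) _ _

theorem totalAngle_zero {b : ℝ} (hb : 0 < b) {Y : ℝ → ℝ} (hY : Y 0 = 0) :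
    totalAngle b Y 0 = √2 * Real.pi := by
  have h2 : (0 : ℝ) < √2 := by positivity
  have h : ∀ φ, angleDensity b Y 0 φ = √2 / 2 := by
    intro φ
    have h1 : √b ^ 2 = b := Real.sq_sqrt hb.le
    have h1' := Real.sqrt_pos.2 hb
    have h3 : √(1 + 1 / b + 0 ^ 2) = √(1 + b) / √b := by
      rw [← Real.sqrt_div (by positivity)]
      congr 1
      field_simp
      ring
    have h4 : √(1 + b) ^ 2 = 1 + b := Real.sq_sqrt (by positivity)
    have h4' : 0 < √(1 + b) := Real.sqrt_pos.2 (by positivity)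
    have h6 : √(2 * (1 + b)) = √2 * √(1 + b) := Real.sqrt_mul (by positivity) _
    simp only [angleDensity, zero_mul, hY, h3, potentialRootDeriv, potentialQuot_zero,
      forceQuot_zero, h6, mul_zero, neg_zero, Real.exp_zero]
    generalize √b = c at *
    generalize √(1 + b) = d at *
    rw [← h4]
    subst h1
    field_simp
    ring
  simp only [totalAngle, h, intervalIntegral.integral_const, smul_eq_mul]
  ring

/-- Dominated convergence: the density tends to `1` where `sin φ > 0` (outer half of the
oscillation) and to `0` where `sin φ < 0` (the passage near the pole, along which the tangent in the
disk does not turn in the limit). -/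
theorem tendsto_totalAngle {b : ℝ} (hb : 0 < b) {Y : ℝ → ℝ} (hY : Continuous Y)
    (htop : Tendsto Y atTop atTop) (hbot : Tendsto Y atBot atBot) :
    Tendsto (totalAngle b Y) atTop (𝓝 Real.pi) := by
  have hb' := Real.sqrt_pos.2 hb
  obtain ⟨C, hC⟩ := exists_abs_le_of_tendsto
    (Continuous.div (by fun_prop) (continuous_potentialRootDeriv hb)
      fun x => (potentialRootDeriv_pos hb x).ne')
    (tendsto_exp_div_potentialRootDeriv_atTop hb) (tendsto_exp_div_potentialRootDeriv_atBot hb)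
  have hcont : ∀ R, Continuous (angleDensity b Y R) := fun R =>
    (continuous_angleDensity hb hY).comp (Continuous.prodMk_right R)
  have hfac : ∀ v : ℝ, 0 ≤ v → |(b + (1 + b) * v) / (1 + v)| ≤ 1 + 2 * b := by
    intro v hv
    rw [abs_of_nonneg (by positivity), div_le_iff₀ (by positivity)]
    nlinarith
  have hbound : ∀ R φ, ‖angleDensity b Y R φ‖ ≤ C / √b * (1 + 2 * b) := by
    intro R φ
    rw [angleDensity, norm_mul, norm_div, Real.norm_eq_abs, Real.norm_eq_abs, Real.norm_eq_abs,
      abs_of_pos hb']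
    have h1 : |Real.exp (b * Y (R * Real.sin φ)) / potentialRootDeriv b (Y (R * Real.sin φ))| ≤ C :=
      hC (Y (R * Real.sin φ))
    have hC0 : 0 ≤ C := (abs_nonneg _).trans h1
    exact mul_le_mul (by gcongr) (hfac _ (by positivity)) (abs_nonneg _) (by positivity)
  have hlim1 : ∀ φ, 0 < Real.sin φ → Tendsto (fun R => angleDensity b Y R φ) atTop (𝓝 1) := by
    intro φ hφ
    have hR : Tendsto (fun R => Y (R * Real.sin φ)) atTop atTop :=
      htop.comp (tendsto_id.atTop_mul_const hφ)
    have h1 := (tendsto_exp_div_potentialRootDeriv_atTop hb).comp hR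
    have hs : Tendsto (fun R : ℝ => √(1 + 1 / b + R ^ 2)) atTop atTop :=
      Real.tendsto_sqrt_atTop.comp (tendsto_atTop_add_const_left _ _ (tendsto_pow_atTop two_ne_zero))
    have h2 := (Real.tendsto_exp_atBot.comp (tendsto_neg_atTop_atBot.comp hR)).div_atTop hs
    have h3 := (h1.div_const √b).mul (((h2.const_mul (1 + b)).const_add b).div (h2.const_add 1)
      (by norm_num))
    have h4 : (√b)⁻¹ / √b * ((b + (1 + b) * 0) / (1 + 0)) = 1 := by
      have := Real.sq_sqrt hb.le
      field_simp
      nlinarith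
    rw [h4] at h3
    exact h3
  have hlim2 : ∀ φ, Real.sin φ < 0 → Tendsto (fun R => angleDensity b Y R φ) atTop (𝓝 0) := by
    intro φ hφ
    have hR : Tendsto (fun R => Y (R * Real.sin φ)) atTop atBot :=
      hbot.comp (tendsto_id.atTop_mul_const_of_neg hφ)
    have h1 := ((tendsto_exp_div_potentialRootDeriv_atBot hb).comp hR).div_const √b
    rw [zero_div] at h1
    refine h1.zero_mul_isBoundedUnder_le (isBoundedUnder_of ⟨1 + 2 * b, fun R => ?_⟩)
    exact hfac _ (by positivity)
  have hae : ∀ c : ℝ, ∀ᵐ x : ℝ, x ≠ c := fun c =>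
    MeasureTheory.compl_mem_ae_iff.2 (MeasureTheory.measure_singleton c)
  have hI1 : Tendsto (fun R => ∫ φ in (0 : ℝ)..Real.pi, angleDensity b Y R φ) atTop
      (𝓝 (∫ _ in (0 : ℝ)..Real.pi, 1)) := by
    refine intervalIntegral.tendsto_integral_filter_of_dominated_convergence
      (fun _ => C / √b * (1 + 2 * b)) (Eventually.of_forall fun R =>
        (hcont R).aestronglyMeasurable) (Eventually.of_forall fun R =>
        Eventually.of_forall fun φ _ => hbound R φ) (by simp) ?_
    filter_upwards [hae Real.pi] with φ h1 h2
    rw [uIoc_of_le Real.pi_pos.le] at h2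
    exact hlim1 φ (Real.sin_pos_of_pos_of_lt_pi h2.1 (h2.2.lt_of_ne h1))
  have hI2 : Tendsto (fun R => ∫ φ in Real.pi..(2 * Real.pi), angleDensity b Y R φ) atTop
      (𝓝 (∫ _ in Real.pi..(2 * Real.pi), 0)) := by
    refine intervalIntegral.tendsto_integral_filter_of_dominated_convergence
      (fun _ => C / √b * (1 + 2 * b)) (Eventually.of_forall fun R =>
        (hcont R).aestronglyMeasurable) (Eventually.of_forall fun R =>
        Eventually.of_forall fun φ _ => hbound R φ) (by simp) ?_
    filter_upwards [hae (2 * Real.pi)] with φ h1 h2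
    rw [uIoc_of_le (by linarith [Real.pi_pos])] at h2
    have h3 := Real.sin_pos_of_pos_of_lt_pi (x := φ - Real.pi) (by linarith [h2.1])
      (by linarith [h2.2.lt_of_ne h1])
    rw [Real.sin_sub_pi] at h3
    exact hlim2 φ (by linarith)
  have := hI1.add hI2
  simp only [intervalIntegral.integral_const, smul_eq_mul, sub_zero, mul_one, mul_zero,
    add_zero] at this
  refine this.congr fun R => ?_
  exact intervalIntegral.integral_add_adjacent_intervals ((hcont R).intervalIntegrable _ _)
    ((hcont R).intervalIntegrable _ _)

/-! ### Profiles with prescribed angular progression -/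

/-- The data from which a convex `p`-elastic curve is built, with `b = 1 / (p - 1)`: the logarithm
`η` of the height (up to a constant), its derivative `η'` and the polar angle `θ`, which is
quasi-periodic with period `T` and progression `Λ`. -/
structure IsProfile (b a T Λ : ℝ) (η η' θ : ℝ → ℝ) : Prop where
  a_pos : 0 < a
  period_pos : 0 < T
  hasDerivAt : ∀ s, HasDerivAt η (η' s) s
  hasDerivAt' : ∀ s, HasDerivAt η' (a ^ 2 * (Real.exp (-2 * η s) - Real.exp (2 * b * η s))) s
  energy : ∀ s, η' s ^ 2 + a ^ 2 * potential b (η s) = 1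
  hasDerivAt_angle : ∀ s, HasDerivAt θ (a / √b * Real.exp (b * η s) * (a * Real.exp (-η s)) /
    (1 - (a * Real.exp (-η s)) ^ 2)) s
  add_period : ∀ s, η (s + T) = η s
  angle_add_period : ∀ s, θ (s + T) = θ s + Λ
  eq_mul_period : ∀ L, 0 < L → Function.Periodic η L → ∃ k : ℕ, L = k * T

/-- A continuous positive function `w`, periodic with period `P`, is the velocity of a motion on
`ℝ` that is defined for all times and advances by `P` in a fixed time `T`. -/
theorem exists_flow_of_periodic {w : ℝ → ℝ} {P : ℝ} (hP : 0 < P) (hw : Continuous w)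
    (hpos : ∀ x, 0 < w x) (hper : Function.Periodic w P) :
    ∃ (T : ℝ) (φ : ℝ → ℝ), 0 < T ∧ StrictMono φ ∧ φ 0 = 0 ∧
      (∀ s, HasDerivAt φ (w (φ s)) s) ∧ ∀ s, φ (s + T) = φ s + P := by
  have hc : Continuous fun x => (w x)⁻¹ := hw.inv₀ fun x => (hpos x).ne'
  have hpos' : ∀ x, 0 < (w x)⁻¹ := fun x => inv_pos.2 (hpos x)
  have hper' : Function.Periodic (fun x => (w x)⁻¹) P := fun x => by simp [hper x]
  have hint : ∀ x y, IntervalIntegrable (fun x => (w x)⁻¹) MeasureTheory.volume x y :=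
    fun x y => hc.intervalIntegrable x y
  obtain ⟨hmono, φ, hφc, hSφ, hφS, hφ⟩ := exists_inverse_of_deriv_pos
    (f := fun x => ∫ t in (0 : ℝ)..x, (w t)⁻¹)
    (fun x => intervalIntegral.integral_hasDerivAt_right (hint 0 x)
      (hc.stronglyMeasurableAtFilter _ _) hc.continuousAt) hpos'
    (hper'.tendsto_atTop_intervalIntegral_of_pos' (hint 0 P) hpos' hP)
    (hper'.tendsto_atBot_intervalIntegral_of_pos' (hint 0 P) hpos' hP)
  refine ⟨∫ t in (0 : ℝ)..P, (w t)⁻¹, φ, ?_, ?_, ?_, fun s => ?_, fun s => ?_⟩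
  · exact intervalIntegral.intervalIntegral_pos_of_pos (hint 0 P) hpos' hP
  · intro x y hxy
    rw [← hmono.lt_iff_lt]
    simpa only [hSφ] using hxy
  · simpa using hφS 0
  · simpa using hφ s
  · rw [← hφS (φ s + P)]
    congr 1
    have := hper'.intervalIntegral_add_eq_add 0 (φ s) hint
    simp only [zero_add] at this
    rw [this, hSφ]

/-- The derivative of `arctan (y / e)`, where `e = a / c * u`, plus `angleDensity` times the
velocity of the phase is the angular velocity. -/
theorem angle_identity {a b c u v w y : ℝ} (hc : 0 < c) (hb : c ^ 2 = b) (hu : 0 < u) (hv : 0 < v)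
    (hw : 0 < w) (ha : 0 < a) (h : y ^ 2 + a ^ 2 * (v ^ 2 + u ^ 2 / b) = 1) :
    1 / (1 + (y / (a / c * u)) ^ 2) *
        ((a ^ 2 * (v ^ 2 - u ^ 2) * (a / c * u) - y * (a / c * (u * (b * y)))) / (a / c * u) ^ 2) +
      u / w / c * ((b + (1 + b) * (v * a)) / (1 + v * a)) * (a * w) =
    a / c * u * (a * v) / (1 - (a * v) ^ 2) := by
  subst hb
  have h1 : 0 < a ^ 2 * (u ^ 2 / c ^ 2) := by positivity
  have hv1 : 0 < 1 - (a * v) ^ 2 := by nlinarith [sq_nonneg y]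
  have h2 : 0 < 1 + v * a := by positivity
  have h3 : 1 + (y / (a / c * u)) ^ 2 = (1 - (a * v) ^ 2) / (a / c * u) ^ 2 := by
    rw [div_pow, show y ^ 2 = 1 - a ^ 2 * (v ^ 2 + u ^ 2 / c ^ 2) by linarith]
    field_simp
    ring
  have h4 : a ^ 2 * (v ^ 2 - u ^ 2) * (a / c * u) - y * (a / c * (u * (c ^ 2 * y))) =
      a / c * u * ((1 + c ^ 2) * (a * v) ^ 2 - c ^ 2) := by
    field_simp
    field_simp at h
    linear_combination -h
  -- Since `a * v` is the inverse height, `1 - a * v` is the factor that degenerates at the pole. It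
  -- cancels because `b + av - (1 + b)(av)^2 = (1 - av)(b + (1 + b)av)`.
  have h5 : 1 - (a * v) ^ 2 = (1 - a * v) * (1 + v * a) := by ring
  have h6 : 1 - a * v ≠ 0 := fun h => by rw [h5, h, zero_mul] at hv1; exact hv1.false
  rw [h3, h4, h5]
  field_simp
  ring

theorem exists_profile {b Λ : ℝ} (hb : 0 < b) (h1 : Real.pi < Λ) (h2 : Λ < √2 * Real.pi) :
    ∃ (a T : ℝ) (η η' θ : ℝ → ℝ), IsProfile b a T Λ η η' θ := by
  obtain ⟨Y, hYc, hXY, hYX, hY⟩ := exists_potentialRoot_inverse hb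
  have hYX0 : Y 0 = 0 := by simpa [potentialRoot] using hYX 0
  have hmono := strictMono_potentialRoot hb
  have hYmono : StrictMono Y := fun x y hxy => by
    rwa [← hmono.lt_iff_lt, hXY, hXY]
  have htop : Tendsto Y atTop atTop :=
    hYmono.monotone.tendsto_atTop_atTop fun x => ⟨_, (hYX x).ge⟩
  have hbot : Tendsto Y atBot atBot :=
    hYmono.monotone.tendsto_atBot_atBot fun x => ⟨_, (hYX x).le⟩
  -- The strict bounds on `Λ` keep `R` away from `0`, the constant solution.
  obtain ⟨R, hR, rfl⟩ : ∃ R, 0 < R ∧ totalAngle b Y R = Λ := by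
    obtain ⟨M, hM, hM0⟩ := (((tendsto_totalAngle hb hYc htop hbot).eventually_lt_const h1).and
      (eventually_gt_atTop 0)).exists
    obtain ⟨R, hR, h⟩ := intermediate_value_Ioo' hM0.le
      (continuous_totalAngle hb hYc).continuousOn ⟨hM, by rwa [totalAngle_zero hb hYX0]⟩
    exact ⟨R, hR.1, h⟩
  have hq : (0 : ℝ) < 1 + 1 / b + R ^ 2 := by positivity
  set a : ℝ := (√(1 + 1 / b + R ^ 2))⁻¹ with ha_def
  have ha : 0 < a := inv_pos.2 (Real.sqrt_pos.2 hq)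
  have ha2 : a ^ 2 * (1 + 1 / b + R ^ 2) = 1 := by
    rw [ha_def, inv_pow, Real.sq_sqrt hq.le, inv_mul_cancel₀ hq.ne']
  have hw := continuous_potentialRootDeriv hb
  -- This phase velocity is the one for which `η = Y (R sin φ)` has derivative `a R cos φ`, in
  -- accordance with the energy equation.
  obtain ⟨T, φ, hT, hφmono, hφ0, hφ, hφT⟩ := exists_flow_of_periodic
    (w := fun x => a * potentialRootDeriv b (Y (R * Real.sin x))) Real.two_pi_pos (by fun_prop)
    (fun x => mul_pos ha (potentialRootDeriv_pos hb _)) (fun x => by simp)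
  have hη : ∀ s, HasDerivAt (fun s => Y (R * Real.sin (φ s))) (a * R * Real.cos (φ s)) s := by
    intro s
    refine ((hY _).comp s (((hφ s).sin).const_mul R)).congr_deriv ?_
    have := (potentialRootDeriv_pos hb (Y (R * Real.sin (φ s)))).ne'
    field_simp
  have hη' : ∀ s, HasDerivAt (fun s => a * R * Real.cos (φ s)) (a ^ 2 *
      (Real.exp (-2 * Y (R * Real.sin (φ s))) - Real.exp (2 * b * Y (R * Real.sin (φ s))))) s := by
    intro s
    refine ((hφ s).cos.const_mul (a * R)).congr_deriv ?_
    have := potentialRoot_mul_deriv hb (Y (R * Real.sin (φ s)))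
    rw [hXY] at this
    linear_combination -a ^ 2 * this
  have henergy : ∀ s, (a * R * Real.cos (φ s)) ^ 2 +
      a ^ 2 * potential b (Y (R * Real.sin (φ s))) = 1 := by
    intro s
    have := potentialRoot_sq hb (Y (R * Real.sin (φ s)))
    rw [hXY] at this
    linear_combination ha2 - a ^ 2 * this + a ^ 2 * R ^ 2 * Real.sin_sq_add_cos_sq (φ s)
  have hBc : Continuous (angleDensity b Y R) :=
    (continuous_angleDensity hb hYc).comp (Continuous.prodMk_right R)
  have hBper : Function.Periodic (angleDensity b Y R) (2 * Real.pi) := fun x => by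
    simp [angleDensity]
  have hB : ∀ x, HasDerivAt (fun x => ∫ t in (0 : ℝ)..x, angleDensity b Y R t)
      (angleDensity b Y R x) x := fun x =>
    intervalIntegral.integral_hasDerivAt_right (hBc.intervalIntegrable _ _)
      (hBc.stronglyMeasurableAtFilter _ _) hBc.continuousAt
  have hc : 0 < √b := Real.sqrt_pos.2 hb
  refine ⟨a, T, fun s => Y (R * Real.sin (φ s)), fun s => a * R * Real.cos (φ s),
    fun s => Real.arctan (a * R * Real.cos (φ s) /
      (a / √b * Real.exp (b * Y (R * Real.sin (φ s))))) +
      ∫ t in (0 : ℝ)..φ s, angleDensity b Y R t,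
    ha, hT, hη, hη', henergy, fun s => ?_, fun s => ?_, fun s => ?_, fun L hL hper => ?_⟩
  · have hε : HasDerivAt (fun s => a / √b * Real.exp (b * Y (R * Real.sin (φ s))))
        (a / √b * (Real.exp (b * Y (R * Real.sin (φ s))) * (b * (a * R * Real.cos (φ s))))) s :=
      (((hη s).const_mul b).exp).const_mul _
    have hε0 : 0 < a / √b * Real.exp (b * Y (R * Real.sin (φ s))) := by positivity
    refine ((((hη' s).div hε hε0.ne').arctan).add ((hB (φ s)).comp s (hφ s))).congr_deriv ?_
    have hen := henergy s
    have hw0 := potentialRootDeriv_pos hb (Y (R * Real.sin (φ s)))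
    have hv := Real.exp_pos (-Y (R * Real.sin (φ s)))
    have hu := Real.exp_pos (b * Y (R * Real.sin (φ s)))
    have e4 : Real.exp (2 * b * Y (R * Real.sin (φ s))) =
        Real.exp (b * Y (R * Real.sin (φ s))) ^ 2 := by
      rw [← Real.exp_nat_mul]; push_cast; ring_nf
    have e5 : Real.exp (-2 * Y (R * Real.sin (φ s))) = Real.exp (-Y (R * Real.sin (φ s))) ^ 2 := by
      rw [← Real.exp_nat_mul]; push_cast; ring_nf
    simp only [potential, e4, e5, angleDensity] at hen ⊢
    rw [div_eq_mul_inv _ (√(1 + 1 / b + R ^ 2)), ← ha_def]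
    have hcb := Real.sq_sqrt hb.le
    simp only [Pi.div_apply]
    exact angle_identity hc hcb hu hv hw0 ha hen
  · simp [hφT]
  · simp only [hφT, Real.cos_add_two_pi, Real.sin_add_two_pi]
    have := hBper.intervalIntegral_add_eq_add 0 (φ s) fun x y => hBc.intervalIntegrable x y
    rw [zero_add] at this
    rw [this, totalAngle, add_assoc]
  · have h : ∀ s, Real.cos (φ (s + L)) = Real.cos (φ s) := by
      intro s
      have h1 : HasDerivAt (fun s => Y (R * Real.sin (φ s))) (a * R * Real.cos (φ (s + L))) s := by
        have := (hη (s + L)).comp_add_const s L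
        rwa [show (fun x => Y (R * Real.sin (φ (x + L)))) = fun s => Y (R * Real.sin (φ s)) from
          funext hper] at this
      exact mul_left_cancel₀ (by positivity) (h1.unique (hη s))
    have h0 := h 0
    rw [hφ0, Real.cos_zero, zero_add, Real.cos_eq_one_iff] at h0
    obtain ⟨n, hn⟩ := h0
    have hL0 : 0 < φ L := by rw [← hφ0]; exact hφmono hL
    have hn0 : 0 ≤ n := by
      by_contra! hneg
      have : (n : ℝ) < 0 := by exact_mod_cast hneg
      nlinarith [Real.two_pi_pos]
    lift n to ℕ using hn0
    refine ⟨n, hφmono.injective ?_⟩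
    have hk : ∀ k : ℕ, φ (k * T) = k * (2 * Real.pi) := by
      intro k
      induction k with
      | zero => simp [hφ0]
      | succ k ih => push_cast; rw [add_mul, one_mul, hφT, ih]; ring
    rw [hk, ← hn]
    simp

/-! ### Curves on the hyperboloid in cylindrical coordinates -/

/-- The vector with radial component `f`, angular component `g` and vertical component `h` at
points with polar angle `t`. -/
noncomputable def polarVec (t f g h : ℝ) : Fin 3 → ℝ :=
  ![f * Real.cos t - g * Real.sin t, f * Real.sin t + g * Real.cos t, h]

theorem lorentz_polarVec (t f g h f' g' h' : ℝ) :
    lorentz (polarVec t f g h) (polarVec t f' g' h') = f * f' + g * g' - h * h' := by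
  simp [lorentz, polarVec]
  linear_combination (f * f' + g * g') * Real.sin_sq_add_cos_sq t

theorem lorentzCross_polarVec (t f g h f' g' h' : ℝ) :
    lorentzCross (polarVec t f g h) (polarVec t f' g' h') =
      polarVec t (g * h' - h * g') (h * f' - f * h') (-(f * g' - g * f')) := by
  simp only [lorentzCross, polarVec]
  ext i
  fin_cases i
  · simp
    ring
  · simp
    ring
  · simp
    linear_combination (f' * g - f * g') * Real.sin_sq_add_cos_sq t

theorem polarVec_add_smul (t f g h f' g' h' c : ℝ) :
    polarVec t f g h + c • polarVec t f' g' h' =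
      polarVec t (f + c * f') (g + c * g') (h + c * h') := by
  ext i
  fin_cases i <;> simp [polarVec] <;> ring

theorem hasDerivAt_polarVec {θ f g h : ℝ → ℝ} {θ' f' g' h' s : ℝ}
    (hθ : HasDerivAt θ θ' s) (hf : HasDerivAt f f' s) (hg : HasDerivAt g g' s)
    (hh : HasDerivAt h h' s) :
    HasDerivAt (fun s => polarVec (θ s) (f s) (g s) (h s))
      (polarVec (θ s) (f' - g s * θ') (g' + f s * θ') h') s := by
  rw [hasDerivAt_pi]
  intro i
  fin_cases i
  · exact ((hf.mul hθ.cos).sub (hg.mul hθ.sin)).congr_deriv (by simp [polarVec]; ring)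
  · exact ((hf.mul hθ.sin).add (hg.mul hθ.cos)).congr_deriv (by simp [polarVec]; ring)
  · exact hh

/-- The curve in `ℝ³` with cylindrical coordinates `r`, `θ`, `z`. -/
noncomputable def cylCurve (r θ z : ℝ → ℝ) (s : ℝ) : Fin 3 → ℝ := polarVec (θ s) (r s) 0 (z s)

/-- A curve on the hyperboloid in cylindrical coordinates with logarithmic height derivative `y`
and angular velocity `e * z / r ^ 2` has unit speed and curvature `(1 + b) * e`, if `y` satisfies a
suitable differential equation. -/
theorem lorentz_deriv_cylCurve {b : ℝ} {r θ z y e : ℝ → ℝ}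
    (hz : ∀ s, HasDerivAt z (z s * y s) s)
    (hy : ∀ s, HasDerivAt y (1 / z s ^ 2 - b * e s ^ 2) s)
    (he : ∀ s, HasDerivAt e (b * y s * e s) s)
    (hr : ∀ s, HasDerivAt r (z s ^ 2 * y s / r s) s)
    (hθ : ∀ s, HasDerivAt θ (e s * z s / r s ^ 2) s)
    (hr0 : ∀ s, 0 < r s) (hz0 : ∀ s, 0 < z s) (hrz : ∀ s, r s ^ 2 = z s ^ 2 - 1)
    (hen : ∀ s, y s ^ 2 + 1 / z s ^ 2 + e s ^ 2 = 1) (s : ℝ) :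
    lorentz (deriv (cylCurve r θ z) s) (deriv (cylCurve r θ z) s) = 1 ∧
    curvature (cylCurve r θ z) s = (1 + b) * e s := by
  have hT : deriv (cylCurve r θ z) = fun s =>
      polarVec (θ s) (z s ^ 2 * y s / r s) (e s * z s / r s) (z s * y s) := by
    funext s
    refine (hasDerivAt_polarVec (hθ s) (hr s) (hasDerivAt_const s (0 : ℝ)) (hz s)).deriv.trans ?_
    have h0 := (hr0 s).ne'
    congr 1
    · ring
    · field_simp
      ring
  -- The energy equation without denominators; together with `hrz` it yields the frame identities
  -- below.
  have hzy2 : z s ^ 2 * y s ^ 2 = r s ^ 2 - z s ^ 2 * e s ^ 2 := by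
    have := hen s
    have := hz0 s
    have := hrz s
    field_simp at *
    linarith
  have hz1 := (hz0 s).ne'
  have hr1 := (hr0 s).ne'
  have hrz1 := hrz s
  -- These are the components of `γ + κ N` with `κ = (1 + b) * e`: the part of `T'` normal to the
  -- hyperboloid is `γ`, because `⟨T', γ⟩ = -1`.
  have hT' : deriv (deriv (cylCurve r θ z)) s = polarVec (θ s)
      (r s - (1 + b) * e s * (e s * z s ^ 2 / r s)) ((1 + b) * e s * (z s * y s / r s))
      (z s - (1 + b) * e s * (e s * z s)) := by
    rw [hT]
    refine (hasDerivAt_polarVec (hθ s) ((((hz s).pow 2).mul (hy s)).div (hr s) hr1)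
      (((he s).mul (hz s)).div (hr s) hr1) ((hz s).mul (hy s))).deriv.trans ?_
    simp only [Pi.mul_apply, Pi.pow_apply, Pi.div_apply]
    generalize z s = z at *
    generalize r s = r at *
    generalize y s = y at *
    generalize e s = e at *
    congr 1
    · field_simp
      norm_num
      linear_combination (2 * r ^ 2 - z ^ 2) * hzy2 + (r ^ 2 - z ^ 2 * e ^ 2) * hrz1
    · field_simp
      ring
    · field_simp
      linear_combination hzy2 + hrz1
  have hN : unitNormal (cylCurve r θ z) s =
      polarVec (θ s) (-(e s * z s ^ 2 / r s)) (z s * y s / r s) (-(e s * z s)) := by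
    rw [unitNormal, hT, cylCurve, lorentzCross_polarVec]
    congr 1
    · field_simp
      ring
    · field_simp
      rw [hrz1]
      ring
    · field_simp
      ring
  constructor
  · rw [hT, lorentz_polarVec]
    field_simp
    linear_combination hzy2 - z s ^ 2 * y s ^ 2 * hrz1
  · have h1 : lorentz (polarVec (θ s) (r s - (1 + b) * e s * (e s * z s ^ 2 / r s))
        ((1 + b) * e s * (z s * y s / r s)) (z s - (1 + b) * e s * (e s * z s)))
        (polarVec (θ s) (r s) 0 (z s)) = -1 := by
      rw [lorentz_polarVec]
      field_simp
      linear_combination r s * hrz1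
    rw [curvature, covDeriv, hT', hN, cylCurve, h1, polarVec_add_smul, lorentz_polarVec]
    field_simp
    linear_combination (1 + b) * e s * (hzy2 - z s ^ 2 * e s ^ 2 * hrz1)

/-! ### From profiles to convex elastic curves -/

/-- The curve in `ℍ²` with the logarithmic height `η` (up to a constant) and polar angle `θ`. -/
noncomputable def profileCurve (a : ℝ) (η θ : ℝ → ℝ) : ℝ → Fin 3 → ℝ :=
  cylCurve (fun s => √((Real.exp (η s) / a) ^ 2 - 1)) θ fun s => Real.exp (η s) / a

theorem profileCurve_two (a : ℝ) (η θ : ℝ → ℝ) (s : ℝ) :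
    profileCurve a η θ s 2 = Real.exp (η s) / a := rfl

theorem rotation_polarVec (φ t f g h : ℝ) :
    rotation φ (polarVec t f g h) = polarVec (t + φ) f g h := by
  ext i
  fin_cases i <;> simp [rotation, polarVec, Real.cos_add, Real.sin_add] <;> ring

theorem polarVec_add_int_mul_two_pi (t f g h : ℝ) (j : ℤ) :
    polarVec (t + j * (2 * Real.pi)) f g h = polarVec t f g h := by
  simp only [polarVec, Real.cos_add_int_mul_two_pi, Real.sin_add_int_mul_two_pi]

theorem sq_div_sqrt_mul_exp {b : ℝ} (hb : 0 < b) (a x : ℝ) :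
    (a / √b * Real.exp (b * x)) ^ 2 = a ^ 2 * Real.exp (2 * b * x) / b := by
  rw [mul_pow, div_pow, Real.sq_sqrt hb.le, ← Real.exp_nat_mul]
  push_cast
  ring_nf

namespace IsProfile

variable {b a T Λ : ℝ} {η η' θ : ℝ → ℝ}

theorem one_div_height_sq (h : IsProfile b a T Λ η η' θ) (s : ℝ) :
    1 / (Real.exp (η s) / a) ^ 2 = a ^ 2 * Real.exp (-2 * η s) := by
  have := h.a_pos
  rw [show -2 * η s = -(((2 : ℕ) : ℝ) * η s) by push_cast; ring, Real.exp_neg, Real.exp_nat_mul]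
  field_simp

theorem energy_height (h : IsProfile b a T Λ η η' θ) (hb : 0 < b) (s : ℝ) :
    η' s ^ 2 + 1 / (Real.exp (η s) / a) ^ 2 + (a / √b * Real.exp (b * η s)) ^ 2 = 1 := by
  rw [sq_div_sqrt_mul_exp hb, h.one_div_height_sq]
  have := h.energy s
  rw [potential] at this
  linear_combination this

theorem one_lt_height_sq (h : IsProfile b a T Λ η η' θ) (hb : 0 < b) (s : ℝ) :
    0 < (Real.exp (η s) / a) ^ 2 - 1 := by
  have ha := h.a_pos
  have h1 := h.energy_height hb s
  have h2 : 0 < (a / √b * Real.exp (b * η s)) ^ 2 := by positivity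
  have h3 : 1 / (Real.exp (η s) / a) ^ 2 < 1 := by nlinarith [sq_nonneg (η' s)]
  rw [div_lt_one (by positivity)] at h3
  linarith

theorem radius_pos (h : IsProfile b a T Λ η η' θ) (hb : 0 < b) (s : ℝ) :
    0 < √((Real.exp (η s) / a) ^ 2 - 1) := Real.sqrt_pos.2 (h.one_lt_height_sq hb s)

/-- Bootstrapping: `η'' ` is a smooth function of `η`, so each order of regularity of the pair `(η,
η')` gives the next. -/
theorem contDiff (h : IsProfile b a T Λ η η' θ) : ContDiff ℝ ∞ η := by
  have hd : deriv η = η' := funext fun s => (h.hasDerivAt s).deriv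
  have hd' := funext fun s => (h.hasDerivAt' s).deriv
  refine contDiff_infty.2 fun n => ?_
  suffices ContDiff ℝ n η ∧ ContDiff ℝ n η' from this.1
  induction n with
  | zero =>
    simp only [Nat.cast_zero, contDiff_zero]
    exact ⟨continuous_iff_continuousAt.2 fun s => (h.hasDerivAt s).continuousAt,
      continuous_iff_continuousAt.2 fun s => (h.hasDerivAt' s).continuousAt⟩
  | succ n ih =>
    obtain ⟨ih, ih'⟩ := ih
    push_cast
    refine ⟨contDiff_succ_iff_deriv.2 ⟨fun s => (h.hasDerivAt s).differentiableAt, by simp,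
      by rwa [hd]⟩, contDiff_succ_iff_deriv.2 ⟨fun s => (h.hasDerivAt' s).differentiableAt,
      by simp, ?_⟩⟩
    rw [hd']
    fun_prop

theorem contDiff_angle (h : IsProfile b a T Λ η η' θ) (hb : 0 < b) : ContDiff ℝ ∞ θ := by
  have hη := h.contDiff
  refine contDiff_infty_iff_deriv.2 ⟨fun s => (h.hasDerivAt_angle s).differentiableAt, ?_⟩
  rw [funext fun s => (h.hasDerivAt_angle s).deriv]
  refine ContDiff.div (by fun_prop) (by fun_prop) fun s => ?_
  have h1 := h.one_div_height_sq s
  have h2 := h.one_lt_height_sq hb s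
  have h3 : 1 / (Real.exp (η s) / a) ^ 2 < 1 := (div_lt_one (by linarith)).2 (by linarith)
  rw [mul_pow, ← Real.exp_nat_mul, show ((2 : ℕ) : ℝ) * -η s = -2 * η s by push_cast; ring, ← h1]
  linarith

theorem contDiff_curve (h : IsProfile b a T Λ η η' θ) (hb : 0 < b) :
    ContDiff ℝ ∞ (profileCurve a η θ) := by
  have hη := h.contDiff
  have hθ := h.contDiff_angle hb
  have hr : ContDiff ℝ ∞ fun s => √((Real.exp (η s) / a) ^ 2 - 1) :=
    ContDiff.sqrt (by fun_prop) fun s => (h.one_lt_height_sq hb s).ne'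
  rw [contDiff_pi]
  intro i
  fin_cases i
  · exact (hr.mul hθ.cos).sub (contDiff_const.mul hθ.sin)
  · exact (hr.mul hθ.sin).add (contDiff_const.mul hθ.cos)
  · exact hη.exp.div_const a

theorem unit_speed_and_curvature (h : IsProfile b a T Λ η η' θ) (hb : 0 < b) (s : ℝ) :
    lorentz (deriv (profileCurve a η θ) s) (deriv (profileCurve a η θ) s) = 1 ∧
    curvature (profileCurve a η θ) s = (1 + b) * (a / √b * Real.exp (b * η s)) := by
  have ha := h.a_pos
  have hz : ∀ s, HasDerivAt (fun s => Real.exp (η s) / a) (Real.exp (η s) / a * η' s) s :=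
    fun s => ((h.hasDerivAt s).exp.div_const a).congr_deriv (by ring)
  refine lorentz_deriv_cylCurve (y := η') (e := fun s => a / √b * Real.exp (b * η s)) hz
    (fun s => (h.hasDerivAt' s).congr_deriv ?_)
    (fun s => (((h.hasDerivAt s).const_mul b).exp.const_mul _).congr_deriv (by ring))
    (fun s => ((((hz s).pow 2).sub_const 1).sqrt (h.one_lt_height_sq hb s).ne').congr_deriv ?_)
    (fun s => (h.hasDerivAt_angle s).congr_deriv ?_)
    (fun s => h.radius_pos hb s) (fun s => by positivity)
    (fun s => Real.sq_sqrt (h.one_lt_height_sq hb s).le) (fun s => h.energy_height hb s) s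
  · rw [sq_div_sqrt_mul_exp hb, h.one_div_height_sq]
    field_simp
  · have := h.radius_pos hb s
    simp only [Pi.pow_apply]
    generalize √((Real.exp (η s) / a) ^ 2 - 1) = r at *
    field_simp
    norm_num
    field_simp
  · have h1 := h.one_lt_height_sq hb s
    simp only [Pi.pow_apply]
    rw [Real.sq_sqrt h1.le, Real.exp_neg]
    have h2 : 1 - (a * (Real.exp (η s))⁻¹) ^ 2 =
      ((Real.exp (η s) / a) ^ 2 - 1) / (Real.exp (η s) / a) ^ 2 := by field_simp
    rw [h2]
    have := h1.ne'
    have := Real.exp_pos (η s)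
    field_simp

theorem curvature_eq (h : IsProfile b a T Λ η η' θ) (hb : 0 < b) (s : ℝ) :
    curvature (profileCurve a η θ) s = (1 + b) * (a / √b * Real.exp (b * η s)) :=
  (h.unit_speed_and_curvature hb s).2

theorem isConvex (h : IsProfile b a T Λ η η' θ) (hb : 0 < b) : IsConvex (profileCurve a η θ) := by
  intro s
  have ha := h.a_pos
  rw [h.curvature_eq hb]
  positivity

theorem isArcLengthCurve (h : IsProfile b a T Λ η η' θ) (hb : 0 < b) :
    IsArcLengthCurve (profileCurve a η θ) where
  smooth := h.contDiff_curve hb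
  mem s := by
    have ha := h.a_pos
    refine ⟨?_, ?_⟩
    · rw [profileCurve, cylCurve, lorentz_polarVec]
      linear_combination Real.sq_sqrt (h.one_lt_height_sq hb s).le
    · rw [profileCurve_two]
      positivity
  unit_speed s := (h.unit_speed_and_curvature hb s).1

/-- Since `b (p - 1) = 1`, the power `κ^(p-1)` is a constant times `exp η`. The equation of motion
and the energy give `(exp η)'' = exp η * (1 - a^2 (1 + 1/b) exp (2bη))`, and the last term matches
`κ^2 = (1 + b)^2 a^2 exp (2bη) / b`. -/
theorem isPElastic (h : IsProfile b a T Λ η η' θ) (hb : 0 < b) {p : ℝ} (hp : (p - 1) * b = 1) :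
    IsPElastic p (profileCurve a η θ) where
  curve := h.isArcLengthCurve hb
  pos _ := h.isConvex hb
  euler_lagrange s := by
    have ha := h.a_pos
    have hκ := h.isConvex hb s
    have h1 : ∀ t, curvature (profileCurve a η θ) t ^ (p - 1) =
        ((1 + b) * (a / √b)) ^ (p - 1) * Real.exp (η t) := by
      intro t
      rw [h.curvature_eq hb, ← mul_assoc, Real.mul_rpow (by positivity) (by positivity),
        ← Real.exp_mul]
      congr 2
      linear_combination η t * hp
    have h2 : curvature (profileCurve a η θ) s ^ (p + 1) =
        curvature (profileCurve a η θ) s ^ (p - 1) * curvature (profileCurve a η θ) s ^ 2 := by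
      rw [← Real.rpow_natCast _ 2, ← Real.rpow_add hκ]
      congr 1
      push_cast
      ring
    rw [h2, funext h1, h1 s, h.curvature_eq hb, mul_pow, sq_div_sqrt_mul_exp hb]
    have hd : deriv (fun t => ((1 + b) * (a / √b)) ^ (p - 1) * Real.exp (η t)) =
        fun t => ((1 + b) * (a / √b)) ^ (p - 1) * (Real.exp (η t) * η' t) :=
      funext fun t => ((h.hasDerivAt t).exp.const_mul _).deriv
    have hd' : HasDerivAt (fun t => ((1 + b) * (a / √b)) ^ (p - 1) * (Real.exp (η t) * η' t)) _ s :=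
      ((h.hasDerivAt s).exp.mul (h.hasDerivAt' s)).const_mul _
    rw [iteratedDeriv_succ, iteratedDeriv_one, hd, hd'.deriv]
    have h3 := h.energy s
    rw [potential] at h3
    have hpb : p = 1 + 1 / b := by
      field_simp
      linarith
    generalize ((1 + b) * (a / √b)) ^ (p - 1) = C
    subst hpb
    generalize Real.exp (2 * b * η s) = u at *
    generalize Real.exp (-2 * η s) = v at *
    generalize Real.exp (η s) = w at *
    field_simp at h3 ⊢
    linear_combination C * w * (b + 1) * h3

theorem periodic (h : IsProfile b a T Λ η η' θ) : Function.Periodic η T := h.add_period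

theorem angle_add_int_mul (h : IsProfile b a T Λ η η' θ) (k : ℤ) (s : ℝ) :
    θ (s + k * T) = θ s + k * Λ := by
  have hT := h.period_pos
  -- Removing the linear drift turns quasi-periodicity into periodicity, which iterates over all
  -- integers.
  have hper : Function.Periodic (fun s => θ s - Λ / T * s) T := fun s => by
    simp only [h.angle_add_period]
    field_simp
    ring
  have := hper.int_mul k s
  field_simp at this
  refine mul_left_cancel₀ hT.ne' ?_
  linear_combination this

theorem isLeastPeriod_curvature (h : IsProfile b a T Λ η η' θ) (hb : 0 < b) :
    IsLeastPeriod (curvature (profileCurve a η θ)) T := by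
  have ha := h.a_pos
  refine ⟨⟨h.period_pos, fun s => ?_⟩, fun L hL => ?_⟩
  · rw [h.curvature_eq hb, h.curvature_eq hb, h.add_period]
  · obtain ⟨hL0, hL⟩ := hL
    obtain ⟨k, hk⟩ := h.eq_mul_period L hL0 fun s => by
      have h1 := hL s
      rw [h.curvature_eq hb, h.curvature_eq hb] at h1
      have h2 := Real.exp_injective (mul_left_cancel₀ (show a / √b ≠ 0 by positivity)
        (mul_left_cancel₀ (show 1 + b ≠ 0 by positivity) h1))
      exact mul_left_cancel₀ hb.ne' h2
    have hk0 : k ≠ 0 := by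
      rintro rfl
      simp [hk] at hL0
    have : (1 : ℝ) ≤ k := by exact_mod_cast Nat.one_le_iff_ne_zero.2 hk0
    rw [hk]
    nlinarith [h.period_pos]

theorem hasNonconstantCurvature (h : IsProfile b a T Λ η η' θ) (hb : 0 < b) :
    HasNonconstantCurvature (profileCurve a η θ) := by
  by_contra hc
  simp only [HasNonconstantCurvature, not_exists, not_not] at hc
  -- A constant curvature would also have the period `T / 2`.
  have := (h.isLeastPeriod_curvature hb).2 ⟨half_pos h.period_pos, fun s => hc _ _⟩
  linarith [h.period_pos]

theorem isPolarAngle (h : IsProfile b a T Λ η η' θ) (hb : 0 < b) :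
    IsPolarAngle (profileCurve a η θ) θ := by
  have ha := h.a_pos
  have key : ∀ s, toDisk (profileCurve a η θ s) =
      ((√((Real.exp (η s) / a) ^ 2 - 1) / (1 + Real.exp (η s) / a) : ℝ) : ℂ) *
        Complex.exp (θ s * Complex.I) := by
    intro s
    apply Complex.ext
    · rw [Complex.re_ofReal_mul, Complex.exp_ofReal_mul_I_re]
      simp [toDisk, profileCurve, cylCurve, polarVec]
      ring
    · rw [Complex.im_ofReal_mul, Complex.exp_ofReal_mul_I_im]
      simp [toDisk, profileCurve, cylCurve, polarVec]
      ring
  have hpos : ∀ s, 0 < √((Real.exp (η s) / a) ^ 2 - 1) / (1 + Real.exp (η s) / a) := fun s =>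
    div_pos (h.radius_pos hb s) (by positivity)
  refine ⟨(h.contDiff_angle hb).continuous, fun s => ?_, fun s => ?_⟩
  · rw [key]
    exact mul_ne_zero (by exact_mod_cast (hpos s).ne') (Complex.exp_ne_zero _)
  · have : ‖toDisk (profileCurve a η θ s)‖ =
        √((Real.exp (η s) / a) ^ 2 - 1) / (1 + Real.exp (η s) / a) := by
      rw [key, norm_mul, Complex.norm_exp_ofReal_mul_I, mul_one, Complex.norm_real,
        Real.norm_of_nonneg (hpos s).le]
    rw [this, key]

theorem hasAngularProgression (h : IsProfile b a T Λ η η' θ) (hb : 0 < b) (k : ℕ) :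
    HasAngularProgression (profileCurve a η θ) (k * T) (k * Λ) :=
  ⟨θ, h.isPolarAngle hb, fun s => by
    have := h.angle_add_int_mul k s
    push_cast at this
    rw [this]
    ring⟩

/-- If `k` times the progression of the polar angle is `φ` modulo `2π`, then translating the
parameter by `k` periods amounts to rotating the curve through `φ`. -/
theorem profileCurve_add (h : IsProfile b a T Λ η η' θ) {k j : ℤ} {φ : ℝ}
    (hk : k * Λ = φ + j * (2 * Real.pi)) (s : ℝ) :
    profileCurve a η θ (s + k * T) = rotation φ (profileCurve a η θ s) := by
  simp only [profileCurve, cylCurve, rotation_polarVec, h.angle_add_int_mul, hk,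
    h.periodic.int_mul k s, ← add_assoc, polarVec_add_int_mul_two_pi]

end IsProfile

/-! ### Closing up and rotational symmetry -/

theorem isOfType_profileCurve {b a T : ℝ} {η η' θ : ℝ → ℝ} {n m : ℕ} (hb : 0 < b) (hm : 0 < m)
    (hnm : Nat.Coprime n m) (h : IsProfile b a T (2 * Real.pi * (n / m)) η η' θ) :
    IsOfType (profileCurve a η θ) n m := by
  have ha := h.a_pos
  have hT := h.period_pos
  have hm' : (0 : ℝ) < m := by exact_mod_cast hm
  have hmT : 0 < m * T := mul_pos hm' hT
  have hrot : ∀ v, rotation 0 v = v := fun v => by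
    ext i
    fin_cases i <;> simp [rotation]
  have hper : Function.Periodic (profileCurve a η θ) (m * T) := fun s => by
    have := h.profileCurve_add (k := m) (j := n) (φ := 0) (by push_cast; field_simp; ring) s
    rw [hrot] at this
    exact_mod_cast this
  refine ⟨T, h.isLeastPeriod_curvature hb, ⟨⟨hmT, hper⟩, fun L hL => ?_⟩, ⟨hper, ?_⟩, ?_⟩
  · obtain ⟨hL0, hL⟩ := hL
    -- The height alone forces `L = k * T`. The horizontal coordinates then force `k n / m` to be an
    -- integer, so `m ∣ k` by coprimality.
    obtain ⟨k, rfl⟩ := h.eq_mul_period L hL0 fun s => by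
      have h1 := congrFun (hL s) 2
      rw [profileCurve_two, profileCurve_two] at h1
      exact Real.exp_injective ((div_left_inj' ha.ne').1 h1)
    have hk0 : 0 < k := by
      rcases Nat.eq_zero_or_pos k with rfl | hk
      · simp at hL0
      · exact hk
    have hη : η (0 + k * T) = η 0 := h.periodic.nat_mul k 0
    have hθ : θ (0 + k * T) = θ 0 + k * (2 * Real.pi * (n / m)) := by
      exact_mod_cast h.angle_add_int_mul k 0
    have hr := (h.radius_pos hb 0).ne'
    have h0 := congrFun (hL 0) 0
    have h1 := congrFun (hL 0) 1
    simp only [profileCurve, cylCurve, polarVec, hη, hθ] at h0 h1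
    simp only [zero_mul, sub_zero, add_zero, Matrix.cons_val_zero, Matrix.cons_val_one] at h0 h1
    replace h0 := mul_left_cancel₀ hr h0
    replace h1 := mul_left_cancel₀ hr h1
    have hcos : Real.cos (k * (2 * Real.pi * (n / m))) = 1 := by
      rw [← add_sub_cancel_left (θ 0) (k * (2 * Real.pi * (n / m) : ℝ)), Real.cos_sub, h0, h1,
        ← sq, ← sq, Real.cos_sq_add_sin_sq]
    obtain ⟨j, hj⟩ := (Real.cos_eq_one_iff _).1 hcos
    have hkn : (k * n : ℤ) = m * j := by
      have hpi := Real.pi_pos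
      field_simp at hj
      have : (k * n : ℝ) = m * j := by linarith
      exact_mod_cast this
    have hdvd : m ∣ k * n := by
      have : (m : ℤ) ∣ (k * n : ℕ) := ⟨j, by exact_mod_cast hkn⟩
      exact_mod_cast this
    have hmk : m ≤ k := Nat.le_of_dvd hk0 (hnm.symm.dvd_of_dvd_mul_right hdvd)
    have : (m : ℝ) ≤ k := by exact_mod_cast hmk
    gcongr
  · have := h.hasAngularProgression hb m
    convert this using 1
    push_cast
    field_simp
  -- A Bézout coefficient of `n` modulo `m` counts the oscillations after which the polar angle has
  -- advanced by `2π / m` modulo `2π`. Rotation through that angle is thus a shift of the parameter.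
  · have hbez := Nat.gcd_eq_gcd_ab n m
    rw [hnm.gcd_eq_one] at hbez
    have hk : ∀ s, profileCurve a η θ (s + (n.gcdA m : ℤ) * T) =
        rotation (2 * Real.pi / m) (profileCurve a η θ s) := by
      refine h.profileCurve_add (j := -n.gcdB m) ?_
      have : (1 : ℝ) = n * (n.gcdA m : ℤ) + m * (n.gcdB m : ℤ) := by exact_mod_cast hbez
      push_cast
      field_simp
      linear_combination -this
    rw [HasFoldSymmetry, ← range_comp]
    have : rotation (2 * Real.pi / m) ∘ profileCurve a η θ =
        profileCurve a η θ ∘ fun s => s + (n.gcdA m : ℤ) * T := funext fun s => (hk s).symm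
    rw [this, (add_right_surjective _).range_comp]

/-- The curves of type `(n, m)`, also in terms of their angular progression. -/
theorem exists_convex_elastic_curve {p : ℝ} (hp : 1 < p) {n m : ℕ} (hnm : Nat.Coprime n m)
    (h1 : (m : ℝ) < 2 * n) (h2 : 2 * (n : ℝ) < √2 * m) :
    ∃ γ : ℝ → Fin 3 → ℝ, IsPElastic p γ ∧ IsClosedCurve γ ∧ HasNonconstantCurvature γ ∧
      IsConvex γ ∧ IsOfType γ n m ∧ ∃ ρ : ℝ, IsLeastPeriod (curvature γ) ρ ∧
        HasAngularProgression γ ρ (2 * Real.pi * (n / m)) := by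
  have hm : 0 < m := by
    rcases Nat.eq_zero_or_pos m with rfl | hm
    -- For `m = 0` the upper bound would read `2 * n < 0`.
    · norm_num at h2
      linarith [Nat.cast_nonneg (α := ℝ) n]
    · exact hm
  have hm' : (0 : ℝ) < m := by exact_mod_cast hm
  have hpi := Real.pi_pos
  have hb : 0 < 1 / (p - 1) := one_div_pos.2 (by linarith)
  obtain ⟨a, T, η, η', θ, h⟩ := exists_profile (Λ := 2 * Real.pi * (n / m)) hb
    (by rw [mul_div_assoc', lt_div_iff₀ hm']; nlinarith)
    (by rw [mul_div_assoc', div_lt_iff₀ hm']; nlinarith)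
  have htype := isOfType_profileCurve hb hm hnm h
  refine ⟨profileCurve a η θ, h.isPElastic hb (mul_one_div_cancel (by linarith)), ?_,
    h.hasNonconstantCurvature hb, h.isConvex hb, htype, T, h.isLeastPeriod_curvature hb, ?_⟩
  · obtain ⟨ρ, -, hρ, -⟩ := htype
    exact ⟨_, hρ.1⟩
  · simpa using h.hasAngularProgression hb 1

end HypElastic

theorem mainTheorem1 (p : ℝ) (hp : 1 < p) :
    (∀ q : ℚ, 1 < 2 * (q : ℝ) → 2 * (q : ℝ) < √2 →
      ∃ γ : ℝ → Fin 3 → ℝ, HypElastic.IsPElastic p γ ∧ HypElastic.IsClosedCurve γ ∧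
        HypElastic.HasNonconstantCurvature γ ∧ HypElastic.IsConvex γ ∧
        HypElastic.IsAssociatedTo γ q) ∧
    (∀ n m : ℕ, Nat.Coprime n m → (m : ℝ) < 2 * n → 2 * (n : ℝ) < √2 * m →
      ∃ γ : ℝ → Fin 3 → ℝ, HypElastic.IsPElastic p γ ∧ HypElastic.IsClosedCurve γ ∧
        HypElastic.HasNonconstantCurvature γ ∧ HypElastic.IsConvex γ ∧
        HypElastic.IsOfType γ n m) := by
  constructor
  · intro q h1 h2
    have hq : (q : ℝ) = (q.num.natAbs : ℝ) / q.den := by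
      have hq0 : 0 < q := by
        have : (0 : ℝ) < q := by linarith
        exact_mod_cast this
      have hn : ((q.num.natAbs : ℤ) : ℝ) = q.num := by
        rw [Int.natAbs_of_nonneg (Rat.num_pos.2 hq0).le]
      rw [Rat.cast_def, ← hn]
      simp
    have hd : (0 : ℝ) < q.den := by exact_mod_cast q.den_pos
    rw [hq] at h1 h2
    rw [mul_div_assoc', lt_div_iff₀ hd, one_mul] at h1
    rw [mul_div_assoc', div_lt_iff₀ hd] at h2
    obtain ⟨γ, hel, hcl, hnc, hcv, -, ρ, hρ, hang⟩ :=
      HypElastic.exists_convex_elastic_curve hp q.reduced h1 h2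
    exact ⟨γ, hel, hcl, hnc, hcv, ρ, hρ, by rwa [hq]⟩
  · intro n m hnm h1 h2
    obtain ⟨γ, hel, hcl, hnc, hcv, htype, -⟩ :=
      HypElastic.exists_convex_elastic_curve hp hnm h1 h2
    exact ⟨γ, hel, hcl, hnc, hcv, htype⟩
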